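/- Let $P\in\mathbb{Z}[X]$ be a polynomial of degree $d\ge 2$ with leading coefficient $-a_d\neq 0$. For an integer $q\ge 1$, let $G_d(q)\subset \mathbb{Z}/q\mathbb{Z}$ be the set of $d$-th powers modulo $q$ and $G_d^{\times}(q)$ the set of $d$-th powers of invertible residue classes modulo $q$; for $G\subset\mathbb{Z}/q\mathbb{Z}$ put $a_dG=\{a_d g : g\in G\}$, and write $b\in a_dG$ for an integer $b$ whose class modulo $q$ lies in $a_dG$. Let $\omega(q)$ be the number of distinct prime factors of $q$, and let $\lambda$ be Lebesgue measure on $\mathbb{R}$. For $\tau\in\mathbb{R}$ let $I^*_\tau(P)$ be the set of $\alpha\in(0,1)$ for which there are infinitely many pairs of integers $(q,b)$, $q\ge 1$, with $$\left|\alpha-\frac{b}{q^d}\right|<\frac{1}{q^{\tau}}\quad\text{and}\quad b\in a_dG_d(q),$$ and let $\tilde I_\tau(P)$ be the set of $\alpha\in(0,1)$ for which there are infinitely many pairs of integers $(q,b)$, $q\ge1$, with $$\left|\alpha-\frac{b}{q^d}\right|<\frac{1}{q^{\tau}},\quad b\in a_dG_d^{\times}(q)\quad\text{and}\quad \gcd(q,da_d)=1.$$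 1. Let $s\in(0,1]$ and let $m\ge 1$ be an integer. Then for almost every $\alpha\in\mathbb{R}$ there are infinitely many pairs of integers $(q,b)$, $q\ge 1$, such that $$\left|\alpha-\frac{b}{q^d}\right|<\frac{1}{q^{d+s}},\quad b\in a_dG_d^{\times}(q),\quad \gcd(q,da_d)=1\quad\text{and}\quad \omega(q)\le m.$$ 2. In particular, $\lambda(\tilde I_\tau(P))=\lambda(I^*_\tau(P))=1$ for every real $\tau\le d+1$. -/

import Mathlib

open MeasureTheory Polynomial

/-- `G_d(q)`: the set of `d`-th powers modulo `q`. -/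
def powerResidues (d q : ℕ) : Set (ZMod q) :=
  {x | ∃ y : ZMod q, x = y ^ d}

/-- `G_d^×(q)`: the set of primitive `d`-th powers modulo `q`, that is, the `d`-th powers of
invertible residue classes. -/
def primitivePowerResidues (d q : ℕ) : Set (ZMod q) :=
  {x | ∃ y : ZMod q, IsUnit y ∧ x = y ^ d}

/-- `a G = {a m : m ∈ G}` for a set `G` of residue classes modulo `q`. -/
def residueDilate {q : ℕ} (a : ℤ) (G : Set (ZMod q)) : Set (ZMod q) :=
  {x | ∃ m ∈ G, x = (a : ZMod q) * m}

/-- The integer `a_d` such that the leading coefficient of `P` is `-a_d`. -/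
noncomputable def negLeadingCoeff (P : ℤ[X]) : ℤ := -P.leadingCoeff

/-- `I*_τ(P)`: the `α ∈ (0,1)` such that `|α - b / q ^ d| < 1 / q ^ τ` with `b ∈ a_d G_d(q)` for
infinitely many pairs of integers `(q, b)`, `q ≥ 1`, where `d = deg P`. -/
def IStar (P : ℤ[X]) (τ : ℝ) : Set ℝ :=
  {α | α ∈ Set.Ioo (0 : ℝ) 1 ∧
    {p : ℕ × ℤ | 1 ≤ p.1 ∧
      |α - (p.2 : ℝ) / (p.1 : ℝ) ^ P.natDegree| < 1 / (p.1 : ℝ) ^ τ ∧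
      (p.2 : ZMod p.1) ∈
        residueDilate (negLeadingCoeff P) (powerResidues P.natDegree p.1)}.Infinite}

/-- `Ĩ_τ(P)`: the `α ∈ (0,1)` such that `|α - b / q ^ d| < 1 / q ^ τ` with `b ∈ a_d G_d^×(q)` and
`gcd(q, d a_d) = 1` for infinitely many pairs of integers `(q, b)`, `q ≥ 1`, where `d = deg P`. -/
def ITilde (P : ℤ[X]) (τ : ℝ) : Set ℝ :=
  {α | α ∈ Set.Ioo (0 : ℝ) 1 ∧
    {p : ℕ × ℤ | 1 ≤ p.1 ∧
      |α - (p.2 : ℝ) / (p.1 : ℝ) ^ P.natDegree| < 1 / (p.1 : ℝ) ^ τ ∧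
      (p.2 : ZMod p.1) ∈
        residueDilate (negLeadingCoeff P) (primitivePowerResidues P.natDegree p.1) ∧
      Int.gcd (p.1 : ℤ) ((P.natDegree : ℤ) * negLeadingCoeff P) = 1}.Infinite}

/-!
Prime denominators `p ∤ 2 * d * a_d` already suffice. For these the power condition retains a
proportion at least `1 / (2 * d)` of the fractions `b / p ^ d`, so their neighbourhoods of radius
`1 / p ^ (d + 1)` on the circle `ℝ / ℤ` have total measure of order `1 / p`, which has divergent
sum. For distinct primes `p < q` the fractions are torsion points of coprime orders: the difference
of a `p`-fraction and a `q`-fraction determines both of them, and there are few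
`(p * q) ^ d`-torsion points near `0`. Hence the neighbourhoods are pairwise quasi-independent, and
the Chung–Erdős inequality gives a limsup set of positive measure. Multiplication by `2 ^ d` maps
the fractions with denominator `p ^ d` to themselves, so by Lebesgue density and the ergodicity of
`x ↦ 2 ^ d * x` this limsup set has full measure.
-/

open Filter Function Metric Topology

section BorelCantelli

variable {Ω ι : Type*} [MeasurableSpace Ω] {μ : Measure Ω} [IsFiniteMeasure μ]

/-- Chung–Erdős inequality: Cauchy–Schwarz in `L²` for the indicator of the union and the sum of
the indicators. -/
theorem sq_sum_measureReal_le_measureReal_biUnion_mul {E : ι → Set Ω}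
    (hE : ∀ i, MeasurableSet (E i)) (F : Finset ι) :
    (∑ i ∈ F, μ.real (E i)) ^ 2 ≤
      μ.real (⋃ i ∈ F, E i) * ∑ i ∈ F, ∑ j ∈ F, μ.real (E i ∩ E j) := by
  let e (s : Set Ω) (hs : MeasurableSet s) : Lp ℝ 2 μ :=
    indicatorConstLp 2 hs (measure_ne_top μ s) 1
  have inner_e {s t : Set Ω} (hs : MeasurableSet s) (ht : MeasurableSet t) :
      inner ℝ (e s hs) (e t ht) = μ.real (s ∩ t) :=
    L2.real_inner_indicatorConstLp_one_indicatorConstLp_one hs ht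
  have hU : MeasurableSet (⋃ i ∈ F, E i) := F.measurableSet_biUnion fun i _ => hE i
  have inter_eq (i : ι) (hi : i ∈ F) : μ.real ((⋃ i ∈ F, E i) ∩ E i) = μ.real (E i) := by
    rw [Set.inter_eq_right.2 (Set.subset_iUnion₂ i hi)]
  have cauchy_schwarz := real_inner_mul_inner_self_le (e _ hU) (∑ i ∈ F, e (E i) (hE i))
  simp only [← sq, inner_sum, sum_inner, inner_e, Set.inter_self,
    Finset.sum_congr rfl inter_eq] at cauchy_schwarz
  rwa [Finset.sum_comm] at cauchy_schwarz

theorem inv_one_add_le_measureReal_biUnion {E : ι → Set Ω} (hE : ∀ i, MeasurableSet (E i))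
    {C : ℝ} (hC : 0 ≤ C)
    (hind : Pairwise fun i j => μ.real (E i ∩ E j) ≤ C * (μ.real (E i) * μ.real (E j)))
    {F : Finset ι} (hF : 1 ≤ ∑ i ∈ F, μ.real (E i)) :
    (1 + C)⁻¹ ≤ μ.real (⋃ i ∈ F, E i) := by
  classical
  set S := ∑ i ∈ F, μ.real (E i)
  have hinter (i j : ι) : μ.real (E i ∩ E j) ≤
      (if i = j then μ.real (E i) else 0) + C * (μ.real (E i) * μ.real (E j)) := by
    split_ifs with hij
    · exact (measureReal_mono Set.inter_subset_left).trans
        (le_add_of_nonneg_right (by positivity))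
    · simpa only [zero_add] using hind hij
  have hoverlap : ∑ i ∈ F, ∑ j ∈ F, μ.real (E i ∩ E j) ≤ (1 + C) * S ^ 2 := calc
    _ ≤ ∑ i ∈ F, ∑ j ∈ F,
          ((if i = j then μ.real (E i) else 0) + C * (μ.real (E i) * μ.real (E j))) :=
      Finset.sum_le_sum fun i _ => Finset.sum_le_sum fun j _ => hinter i j
    _ = S + C * S ^ 2 := by
      simp only [Finset.sum_add_distrib, Finset.sum_ite_eq, Finset.sum_ite_mem, Finset.inter_self,
        ← Finset.mul_sum, sq, Finset.sum_mul_sum, S]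
    _ ≤ (1 + C) * S ^ 2 := by nlinarith
  have hS : 0 < S ^ 2 := by positivity
  rw [inv_le_iff_one_le_mul₀ (by positivity)]
  refine le_of_mul_le_mul_right ?_ hS
  calc 1 * S ^ 2 = S ^ 2 := one_mul _
    _ ≤ μ.real (⋃ i ∈ F, E i) * ∑ i ∈ F, ∑ j ∈ F, μ.real (E i ∩ E j) :=
      sq_sum_measureReal_le_measureReal_biUnion_mul hE F
    _ ≤ μ.real (⋃ i ∈ F, E i) * ((1 + C) * S ^ 2) := by gcongr
    _ = μ.real (⋃ i ∈ F, E i) * (1 + C) * S ^ 2 := by ring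

theorem le_measureReal_limsup {E : ℕ → Set Ω} (hE : ∀ i, MeasurableSet (E i)) {c : ℝ}
    (hc : ∀ N, c ≤ μ.real (⋃ i ≥ N, E i)) : c ≤ μ.real (limsup E atTop) := by
  have hanti : Antitone fun N => ⋃ i ≥ N, E i := fun M N hMN =>
    Set.biUnion_subset_biUnion_left fun i hi => hMN.trans hi
  have htail (N : ℕ) : NullMeasurableSet (⋃ i ≥ N, E i) μ :=
    (MeasurableSet.biUnion (Set.to_countable _) fun i _ => hE i).nullMeasurableSet
  have hlim := (ENNReal.tendsto_toReal (measure_ne_top μ _)).comp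
    (tendsto_measure_iInter_atTop htail hanti ⟨0, measure_ne_top μ _⟩)
  rw [limsup_eq_iInf_iSup_of_nat]
  exact ge_of_tendsto' hlim hc

theorem exists_finset_le_sum_of_not_summable {a : ℕ → ℝ} (ha : ∀ i, 0 ≤ a i) (hs : ¬ Summable a)
    (B : ℝ) (N : ℕ) : ∃ F : Finset ℕ, (∀ i ∈ F, N ≤ i) ∧ B ≤ ∑ i ∈ F, a i := by
  have htail : ¬ Summable fun i => a (i + N) := mt (summable_nat_add_iff N).1 hs
  have hlim := (not_summable_iff_tendsto_nat_atTop_of_nonneg fun i => ha (i + N)).1 htail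
  obtain ⟨n, hn⟩ := (hlim.eventually_ge_atTop B).exists
  exact ⟨(Finset.range n).map (addRightEmbedding N), by simp, by simpa using hn⟩

theorem measure_limsup_ne_zero_of_quasiIndependent {E : ℕ → Set Ω}
    (hE : ∀ i, MeasurableSet (E i)) (hs : ¬ Summable fun i => μ.real (E i)) {C : ℝ} (hC : 0 ≤ C)
    (hind : Pairwise fun i j => μ.real (E i ∩ E j) ≤ C * (μ.real (E i) * μ.real (E j))) :
    μ (limsup E atTop) ≠ 0 := by
  have htail (N : ℕ) : (1 + C)⁻¹ ≤ μ.real (⋃ i ≥ N, E i) := by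
    obtain ⟨F, hFN, hF⟩ :=
      exists_finset_le_sum_of_not_summable (fun i => measureReal_nonneg) hs 1 N
    exact (inv_one_add_le_measureReal_biUnion hE hC hind hF).trans
      (measureReal_mono (Set.biUnion_subset_biUnion_left hFN) (measure_ne_top μ _))
  have hpos : 0 < μ.real (limsup E atTop) :=
    (by positivity : 0 < (1 + C)⁻¹).trans_le (le_measureReal_limsup hE htail)
  exact (measureReal_ne_zero_iff (measure_ne_top μ _)).1 hpos.ne'

end BorelCantelli

section AddCircle

variable {T : ℝ} [hT : Fact (0 < T)]

theorem div_le_dist_of_nsmul_eq_zero {N : ℕ} (hN : 0 < N) {x y : AddCircle T} (hx : N • x = 0)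
    (hy : N • y = 0) (hxy : x ≠ y) : T / N ≤ dist x y := by
  have hsub : N • (x - y) = 0 := by rw [smul_sub, hx, hy, sub_zero]
  have hfin : IsOfFinAddOrder (x - y) := isOfFinAddOrder_iff_nsmul_eq_zero.2 ⟨N, hN, hsub⟩
  rw [div_le_iff₀' (by positivity), dist_eq_norm, ← nsmul_eq_mul]
  exact (AddCircle.le_add_order_smul_norm_of_isOfFinAddOrder hfin (sub_ne_zero.2 hxy)).trans
    (nsmul_le_nsmul_left (norm_nonneg _) (addOrderOf_le_of_nsmul_eq_zero hN hsub))

theorem volume_real_ball_addCircle (x : AddCircle T) {r : ℝ} (hr : 0 ≤ r) :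
    volume.real (ball x r) = min T (2 * r) := by
  rw [← measureReal_congr AddCircle.closedBall_ae_eq_ball, measureReal_def,
    AddCircle.volume_closedBall, ENNReal.toReal_ofReal (le_min hT.out.le (by positivity))]

theorem volume_real_thickening_le {S : Set (AddCircle T)} (hS : S.Finite) {r : ℝ} (hr : 0 ≤ r) :
    volume.real (thickening r S) ≤ S.ncard * (2 * r) := by
  lift S to Finset (AddCircle T) using hS
  rw [thickening_eq_biUnion_ball, Set.ncard_coe_finset, ← nsmul_eq_mul]
  refine (measureReal_biUnion_finset_le S _).trans (Finset.sum_le_card_nsmul _ _ _ fun x _ => ?_)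
  exact (volume_real_ball_addCircle x hr).trans_le (min_le_right _ _)

theorem volume_real_thickening_of_separated {S : Set (AddCircle T)} (hS : S.Finite) {r : ℝ}
    (hr : 0 ≤ r) (hrT : 2 * r ≤ T) (hsep : S.Pairwise fun x y => 2 * r ≤ dist x y) :
    volume.real (thickening r S) = S.ncard * (2 * r) := by
  lift S to Finset (AddCircle T) using hS
  have hdisj : (S : Set (AddCircle T)).PairwiseDisjoint fun x => ball x r :=
    fun x hx y hy hxy => ball_disjoint_ball (by simpa only [two_mul] using hsep hx hy hxy)
  rw [thickening_eq_biUnion_ball, Set.ncard_coe_finset, ← nsmul_eq_mul]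
  refine (measureReal_biUnion_finset hdisj fun x _ => measurableSet_ball).trans
    (Finset.sum_eq_card_nsmul fun x _ => ?_)
  rw [volume_real_ball_addCircle x hr, min_eq_right hrT]

/-- Packing: the intervals of length `T / N` centred at these points are disjoint. -/
theorem ncard_torsion_inter_ball_le {N : ℕ} (hN : 0 < N) {ρ : ℝ} (hρ : 0 ≤ ρ) :
    ({x : AddCircle T | N • x = 0} ∩ ball 0 ρ).ncard ≤ 2 * N * ρ / T + 1 := by
  have hT0 : 0 < T := hT.out
  set S := {x : AddCircle T | N • x = 0} ∩ ball 0 ρ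
  set r := T / (2 * N) with hr
  have hr2 : 2 * r = T / N := by rw [hr]; field_simp
  have hS : S.Finite := (AddCircle.finite_torsion T hN).subset Set.inter_subset_left
  have hpacked : volume.real (thickening r S) = S.ncard * (2 * r) := by
    refine volume_real_thickening_of_separated hS (by positivity) ?_ fun x hx y hy hxy => ?_
    · rw [hr2]
      exact div_le_self hT0.le (by exact_mod_cast hN)
    · rw [hr2]
      exact div_le_dist_of_nsmul_eq_zero hN hx.1 hy.1 hxy
  have hsub : thickening r S ⊆ ball 0 (ρ + r) := by
    rw [← thickening_singleton]
    refine (thickening_subset_of_subset r Set.inter_subset_right).trans ?_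
    rw [← thickening_singleton, add_comm]
    exact thickening_thickening_subset r ρ {0}
  have hvol : S.ncard * (2 * r) ≤ 2 * (ρ + r) := by
    rw [← hpacked]
    exact (measureReal_mono hsub).trans
      ((volume_real_ball_addCircle 0 (by positivity)).trans_le (min_le_right _ _))
  rw [← le_div_iff₀ (by positivity)] at hvol
  refine hvol.trans_eq ?_
  rw [hr]
  field_simp

theorem eq_and_eq_of_sub_eq_sub_of_coprime {A : Type*} [AddCommGroup A] {M N : ℕ}
    (hMN : M.Coprime N) {x x' y y' : A} (hx : M • x = 0) (hx' : M • x' = 0) (hy : N • y = 0)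
    (hy' : N • y' = 0) (h : x - y = x' - y') : x = x' ∧ y = y' := by
  have hsub : x - x' = y - y' := by rw [sub_eq_sub_iff_sub_eq_sub, h]
  have hM : M • (x - x') = 0 := by rw [smul_sub, hx, hx', sub_zero]
  have hN : N • (x - x') = 0 := by rw [hsub, smul_sub, hy, hy', sub_zero]
  have hzero : x - x' = 0 := by
    simpa only [hMN.gcd_eq_one, one_nsmul] using gcd_nsmul_eq_zero.2 ⟨hM, hN⟩
  exact ⟨sub_eq_zero.1 hzero, sub_eq_zero.1 (hsub ▸ hzero)⟩

theorem thickening_inter_thickening_subset {X : Type*} [PseudoMetricSpace X] (r ρ : ℝ)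
    (S S' : Set X) :
    thickening r S ∩ thickening ρ S' ⊆ thickening ρ (S' ∩ thickening (r + ρ) S) := by
  rintro z ⟨hz, hz'⟩
  obtain ⟨x, hx, hzx⟩ := mem_thickening_iff.1 hz
  obtain ⟨y, hy, hzy⟩ := mem_thickening_iff.1 hz'
  refine mem_thickening_iff.2 ⟨y, ⟨hy, mem_thickening_iff.2 ⟨x, hx, ?_⟩⟩, hzy⟩
  calc dist y x ≤ dist z y + dist z x := by
        simpa only [dist_comm z y] using dist_triangle y z x
    _ < r + ρ := by linarith

/-- By coprimality, a point `y` of `S'` is determined by its difference with a nearby point of `S`,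
and this difference is an `(M * N)`-torsion point close to `0`. -/
theorem ncard_inter_thickening_le_of_coprime {M N : ℕ} (hM : 0 < M) (hN : 0 < N)
    (hMN : M.Coprime N) {S S' : Set (AddCircle T)} (hS : ∀ x ∈ S, M • x = 0)
    (hS' : ∀ y ∈ S', N • y = 0) {ρ : ℝ} (hρ : 0 ≤ ρ) :
    (S' ∩ thickening ρ S).ncard ≤ 2 * (M * N : ℕ) * ρ / T + 1 := by
  have hnear (y : AddCircle T) (hy : y ∈ S' ∩ thickening ρ S) : ∃ x ∈ S, dist y x < ρ :=
    mem_thickening_iff.1 hy.2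
  choose! f hfS hf using hnear
  refine le_trans (Nat.cast_le.2 ?_) (ncard_torsion_inter_ball_le (Nat.mul_pos hM hN) hρ)
  refine Set.ncard_le_ncard_of_injOn (fun y => y - f y) (fun y hy => ⟨?_, ?_⟩) (fun y hy z hz h =>
    ?_) ((AddCircle.finite_torsion T (Nat.mul_pos hM hN)).subset Set.inter_subset_left)
  · have hfy : (M * N) • f y = 0 := by rw [mul_comm, mul_smul, hS _ (hfS y hy), smul_zero]
    have hy' : (M * N) • y = 0 := by rw [mul_smul, hS' y hy.1, smul_zero]
    simp only [Set.mem_ofPred_eq, smul_sub, hy', hfy, sub_zero]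
  · rw [mem_ball_zero_iff, ← dist_eq_norm]
    exact hf y hy
  · exact (eq_and_eq_of_sub_eq_sub_of_coprime hMN.symm (hS' y hy.1) (hS' z hz.1)
      (hS _ (hfS y hy)) (hS _ (hfS z hz)) h).1

theorem volume_real_thickening_inter_thickening_le_of_coprime {M N : ℕ} (hM : 0 < M)
    (hN : 0 < N) (hMN : M.Coprime N) {S S' : Set (AddCircle T)} (hS : ∀ x ∈ S, M • x = 0)
    (hS' : ∀ y ∈ S', N • y = 0) {r ρ : ℝ} (hr : 0 ≤ r) (hρ : 0 ≤ ρ) :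
    volume.real (thickening r S ∩ thickening ρ S') ≤
      (2 * (M * N : ℕ) * (r + ρ) / T + 1) * (2 * ρ) := by
  have hfin : (S' ∩ thickening (r + ρ) S).Finite :=
    (AddCircle.finite_torsion T hN).subset fun y hy => hS' y hy.1
  calc volume.real (thickening r S ∩ thickening ρ S')
      ≤ volume.real (thickening ρ (S' ∩ thickening (r + ρ) S)) :=
        measureReal_mono (thickening_inter_thickening_subset r ρ S S')
    _ ≤ (S' ∩ thickening (r + ρ) S).ncard * (2 * ρ) := volume_real_thickening_le hfin hρ
    _ ≤ _ := by
        gcongr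
        exact ncard_inter_thickening_le_of_coprime hM hN hMN hS hS' (by positivity)

theorem ae_coe_addCircle_of_ae {p : AddCircle T → Prop} (h : ∀ᵐ x, p x) : ∀ᵐ α : ℝ, p α := by
  have hper (n : ℤ) : ∀ᵐ α : ℝ ∂volume.restrict (Set.Ioc (0 + n • T) (0 + (n + 1) • T)), p α := by
    rw [add_one_zsmul, ← add_assoc]
    exact (AddCircle.measurePreserving_mk T _).quasiMeasurePreserving.ae h
  have hunion := (ae_restrict_iUnion_iff _ fun α : ℝ => p α).2 hper
  rwa [iUnion_Ioc_add_zsmul hT.out, Measure.restrict_univ] at hunion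

theorem image_nsmul_thickening_subset {A : Type*} [SeminormedAddCommGroup A] {k : ℕ} (hk : 0 < k)
    (r : ℝ) {S : Set A} (hS : ∀ x ∈ S, k • x ∈ S) :
    (fun x => k • x) '' thickening r S ⊆ thickening (k * r) S := by
  rintro _ ⟨x, hx, rfl⟩
  obtain ⟨y, hy, hxy⟩ := mem_thickening_iff.1 hx
  refine mem_thickening_iff.2 ⟨k • y, hS y hy, ?_⟩
  calc dist (k • x) (k • y) = ‖k • (x - y)‖ := by rw [dist_eq_norm, smul_sub]
    _ ≤ k * dist x y := by simpa only [dist_eq_norm] using norm_nsmul_le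
    _ < k * r := by gcongr

/-- Zero–one law: up to a null set, the limsup set does not see the factor `k` by which
multiplication by `k` enlarges the neighbourhoods, so it is invariant under an ergodic map. -/
theorem ae_frequently_mem_thickening_of_measure_limsup_ne_zero {S : ℕ → Set (AddCircle T)}
    {r : ℕ → ℝ} (hr : Tendsto r atTop (𝓝 0)) {k : ℕ} (hk : 1 < k)
    (hS : ∀ n, ∀ x ∈ S n, k • x ∈ S n)
    (hpos : volume (limsup (fun n => thickening (r n) (S n)) atTop) ≠ 0) :
    ∀ᵐ x, ∃ᶠ n in atTop, x ∈ thickening (r n) (S n) := by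
  set B : Set (AddCircle T) := limsup (fun n => thickening (r n) (S n)) atTop
  have hBmeas : MeasurableSet B :=
    MeasurableSet.measurableSet_limsup fun n => isOpen_thickening.measurableSet
  have himage : (fun x => k • x) '' B ⊆ limsup (fun n => thickening (k * r n) (S n)) atTop := by
    rintro _ ⟨x, hx, rfl⟩
    exact mem_limsup_iff_frequently_mem.2 ((mem_limsup_iff_frequently_mem.1 hx).mono fun n hn =>
      image_nsmul_thickening_subset (by omega) (r n) (hS n) (Set.mem_image_of_mem _ hn))
  have hscale : (limsup (fun n => thickening (k * r n) (S n)) atTop : Set (AddCircle T))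
      =ᵐ[volume] B := by
    simpa only [blimsup_true] using
      blimsup_thickening_mul_ae_eq volume (fun _ => True) S (by positivity) r hr
  have hinv : (fun x => k • x) '' B ≤ᵐ[volume] B :=
    himage.eventuallyLE.trans hscale.le
  have hfull := ((AddCircle.ergodic_nsmul hk).ae_empty_or_univ_of_image_ae_le
    hBmeas.nullMeasurableSet hinv).resolve_left fun hempty => hpos (ae_eq_empty.1 hempty)
  filter_upwards [eventuallyEq_univ.1 hfull] with x hx
  exact mem_limsup_iff_frequently_mem.1 hx

end AddCircle

section ResidueFractions

/-- The fractions `b / q ^ d` modulo `1`, over the integers `b` whose residue class modulo `q` lies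
in `R`: the points around which the approximation sets are the neighbourhoods. -/
def residueFractions (d : ℕ) {q : ℕ} (R : Set (ZMod q)) : Set UnitAddCircle :=
  {x | ∃ b : ℤ, (b : ZMod q) ∈ R ∧ (((b : ℝ) / (q : ℝ) ^ d : ℝ) : UnitAddCircle) = x}

variable {d q : ℕ} {R : Set (ZMod q)}

theorem pow_nsmul_eq_zero_of_mem_residueFractions (hq : q ≠ 0) {x : UnitAddCircle}
    (hx : x ∈ residueFractions d R) : q ^ d • x = 0 := by
  obtain ⟨b, -, rfl⟩ := hx
  have hqd : (q : ℝ) ^ d ≠ 0 := by positivity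
  rw [← AddCircle.coe_nsmul, nsmul_eq_mul, Nat.cast_pow, mul_div_cancel₀ _ hqd]
  exact AddCircle.coe_eq_zero_iff _ |>.2 ⟨b, by simp⟩

theorem nsmul_mem_residueFractions {k : ℕ} (hk : ∀ x ∈ R, (k : ZMod q) * x ∈ R)
    {x : UnitAddCircle} (hx : x ∈ residueFractions d R) : k • x ∈ residueFractions d R := by
  obtain ⟨b, hb, rfl⟩ := hx
  refine ⟨k * b, by simpa using hk _ hb, ?_⟩
  rw [← AddCircle.coe_nsmul, nsmul_eq_mul, ← mul_div_assoc]
  push_cast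
  rfl

theorem residueFractions_eq_image [NeZero q] (hd : d ≠ 0) :
    residueFractions d R =
      ZMod.toAddCircle '' ((ZMod.castHom (dvd_pow_self q hd) (ZMod q)) ⁻¹' R) := by
  ext x
  constructor
  · rintro ⟨b, hb, rfl⟩
    exact ⟨(b : ZMod (q ^ d)), by simpa using hb, by simp [ZMod.toAddCircle_intCast]⟩
  · rintro ⟨y, hy, rfl⟩
    obtain ⟨b, rfl⟩ := ZMod.intCast_surjective y
    exact ⟨b, by simpa using hy, by simp [ZMod.toAddCircle_intCast]⟩

theorem ncard_preimage_mul_card_of_surjective {G H : Type*} [AddGroup G] [AddGroup H]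
    {f : G →+ H} (hf : Surjective f) (R : Set H) :
    (f ⁻¹' R).ncard * Nat.card H = R.ncard * Nat.card G := by
  let e := QuotientAddGroup.quotientKerEquivOfSurjective f hf
  have hfiber : (f ⁻¹' R).ncard = Nat.card f.ker * R.ncard := calc
    (f ⁻¹' R).ncard = Nat.card (f.ker × (e ⁻¹' R)) :=
      Nat.card_congr (QuotientAddGroup.preimageMkEquivAddSubgroupProdSet f.ker (e ⁻¹' R))
    _ = Nat.card f.ker * R.ncard := by
      rw [Nat.card_prod, Nat.card_coe_set_eq,
        Set.ncard_preimage_of_injective_subset_range e.injective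
          (by simp only [e.surjective.range_eq, Set.subset_univ])]
  rw [hfiber, f.ker.card_eq_card_quotient_mul_card_addSubgroup, Nat.card_congr e.toEquiv]
  ring

theorem ncard_residueFractions_mul (hd : d ≠ 0) (hq : q ≠ 0) (R : Set (ZMod q)) :
    (residueFractions d R).ncard * q = R.ncard * q ^ d := by
  have : NeZero q := ⟨hq⟩
  have hsurj := ZMod.castHom_surjective (dvd_pow_self q hd)
  rw [residueFractions_eq_image hd, Set.ncard_image_of_injective _ (ZMod.toAddCircle_injective _)]
  simpa only [Nat.card_zmod, AddMonoidHom.coe_coe] using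
    ncard_preimage_mul_card_of_surjective
      (f := (ZMod.castHom (dvd_pow_self q hd) (ZMod q) : ZMod (q ^ d) →+ ZMod q)) hsurj R

theorem volume_real_thickening_residueFractions (hd : d ≠ 0) (hq : 2 ≤ q) (R : Set (ZMod q)) :
    volume.real (thickening (1 / (q : ℝ) ^ (d + 1)) (residueFractions d R)) =
      2 * R.ncard / (q : ℝ) ^ 2 := by
  have htorsion (x) (hx : x ∈ residueFractions d R) : q ^ d • x = 0 :=
    pow_nsmul_eq_zero_of_mem_residueFractions (by omega) hx
  have hradius : 2 * (1 / (q : ℝ) ^ (d + 1)) ≤ 1 / (q ^ d : ℕ) := by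
    rw [mul_one_div, Nat.cast_pow, pow_succ', div_le_div_iff₀ (by positivity) (by positivity),
      one_mul]
    gcongr
    exact_mod_cast hq
  have hfin : (residueFractions d R).Finite :=
    (AddCircle.finite_torsion 1 (by positivity)).subset htorsion
  have hcard : ((residueFractions d R).ncard : ℝ) * q = R.ncard * (q : ℝ) ^ d :=
    mod_cast ncard_residueFractions_mul hd (by omega) R
  rw [volume_real_thickening_of_separated hfin (by positivity)
    (hradius.trans (div_le_self zero_le_one (by exact_mod_cast Nat.one_le_pow _ _ (by omega))))
    fun x hx y hy hxy => hradius.trans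
      (div_le_dist_of_nsmul_eq_zero (by positivity) (htorsion x hx) (htorsion y hy) hxy)]
  field_simp
  linear_combination (q : ℝ) * hcard

theorem volume_real_inter_thickening_residueFractions_le (hd : d ≠ 0) (hq : q ≠ 0) {q' : ℕ}
    (hqq' : q ≤ q') (hcop : q.Coprime q') (R : Set (ZMod q)) (R' : Set (ZMod q')) :
    volume.real (thickening (1 / (q : ℝ) ^ (d + 1)) (residueFractions d R) ∩
      thickening (1 / (q' : ℝ) ^ (d + 1)) (residueFractions d R')) ≤ 10 / (q * q') := by
  have hq' : q' ≠ 0 := by omega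
  have hqq'R : (q : ℝ) ≤ q' := by exact_mod_cast hqq'
  have hone : 1 ≤ (q' : ℝ) ^ d / q := by
    rw [one_le_div (by positivity)]
    exact hqq'R.trans (le_self_pow₀ (by exact_mod_cast Nat.one_le_iff_ne_zero.2 hq') hd)
  refine (volume_real_thickening_inter_thickening_le_of_coprime (by positivity) (by positivity)
    (hcop.pow d d) (fun x => pow_nsmul_eq_zero_of_mem_residueFractions hq)
    (fun x => pow_nsmul_eq_zero_of_mem_residueFractions hq') (by positivity)
    (by positivity)).trans ?_
  calc (2 * ((q ^ d * q' ^ d : ℕ) : ℝ) * (1 / (q : ℝ) ^ (d + 1) + 1 / (q' : ℝ) ^ (d + 1)) / 1 + 1)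
        * (2 * (1 / (q' : ℝ) ^ (d + 1)))
      ≤ (2 * ((q ^ d * q' ^ d : ℕ) : ℝ) * (1 / (q : ℝ) ^ (d + 1) + 1 / (q : ℝ) ^ (d + 1)) / 1 + 1)
        * (2 * (1 / (q' : ℝ) ^ (d + 1))) := by gcongr
    _ = (4 * ((q' : ℝ) ^ d / q) + 1) * (2 * (1 / (q' : ℝ) ^ (d + 1))) := by
        push_cast
        field_simp
        ring
    _ ≤ (5 * ((q' : ℝ) ^ d / q)) * (2 * (1 / (q' : ℝ) ^ (d + 1))) := by
        gcongr
        linarith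
    _ = 10 / (q * q') := by
        field_simp
        ring

theorem coe_mem_thickening_residueFractions_iff (hd : d ≠ 0) (hq : q ≠ 0) {ρ α : ℝ} :
    (α : UnitAddCircle) ∈ thickening ρ (residueFractions d R) ↔
      ∃ b : ℤ, (b : ZMod q) ∈ R ∧ |α - b / (q : ℝ) ^ d| < ρ := by
  have hqd : (q : ℝ) ^ d ≠ 0 := by positivity
  constructor
  · intro hα
    obtain ⟨_, ⟨b, hb, rfl⟩, hdist⟩ := mem_thickening_iff.1 hα
    rw [dist_eq_norm, ← AddCircle.coe_sub, UnitAddCircle.norm_eq] at hdist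
    set n := round (α - b / (q : ℝ) ^ d)
    refine ⟨b + n * q ^ d, by simpa [hd] using hb, ?_⟩
    convert hdist using 2
    push_cast
    field_simp
    ring
  · rintro ⟨b, hb, hdist⟩
    refine mem_thickening_iff.2 ⟨_, ⟨b, hb, rfl⟩, ?_⟩
    rw [dist_eq_norm, ← AddCircle.coe_sub, UnitAddCircle.norm_eq]
    exact (round_le _ 0 |>.trans_eq (by simp)).trans_lt hdist

theorem tendsto_one_div_pow_succ_of_pairwise_coprime {q : ℕ → ℕ} (hq : ∀ n, 2 ≤ q n)
    (hcop : Pairwise (Nat.Coprime on q)) (d : ℕ) :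
    Tendsto (fun n => 1 / (q n : ℝ) ^ (d + 1)) atTop (𝓝 0) := by
  have hinj : Injective q := fun m n hmn => by_contra fun hne => by
    have hself : (q m).Coprime (q m) := by simpa only [onFun, ← hmn] using hcop hne
    have := hq m
    rw [Nat.coprime_self] at hself
    omega
  simp only [one_div]
  exact tendsto_inv_atTop_zero.comp ((tendsto_pow_atTop d.succ_ne_zero).comp
    (tendsto_natCast_atTop_atTop.comp hinj.nat_tendsto_atTop))

theorem measure_limsup_thickening_residueFractions_ne_zero (hd : d ≠ 0) {q : ℕ → ℕ}
    (hq : ∀ n, 2 ≤ q n) (hcop : Pairwise (Nat.Coprime on q))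
    (hsum : ¬ Summable fun n => 1 / (q n : ℝ)) {R : ∀ n, Set (ZMod (q n))} {c : ℝ} (hc : 0 < c)
    (hR : ∀ n, c * q n ≤ (R n).ncard) :
    volume (limsup (fun n => thickening (1 / (q n : ℝ) ^ (d + 1)) (residueFractions d (R n)))
      atTop) ≠ 0 := by
  set E : ℕ → Set UnitAddCircle :=
    fun n => thickening (1 / (q n : ℝ) ^ (d + 1)) (residueFractions d (R n))
  have hq0 (n : ℕ) : (0 : ℝ) < q n := by exact_mod_cast two_pos.trans_le (hq n)
  have hlower (n : ℕ) : 2 * c * (1 / q n) ≤ volume.real (E n) := by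
    have hq0n := hq0 n
    rw [volume_real_thickening_residueFractions hd (hq n), le_div_iff₀ (by positivity)]
    field_simp
    linarith [hR n]
  have hoverlap : Pairwise fun m n => volume.real (E m ∩ E n) ≤ 10 / (q m * q n) := by
    intro m n hmn
    rcases le_total (q m) (q n) with hle | hle
    · exact volume_real_inter_thickening_residueFractions_le hd (by have := hq m; omega) hle
        (hcop hmn) _ _
    · rw [Set.inter_comm, mul_comm (q m : ℝ)]
      exact volume_real_inter_thickening_residueFractions_le hd (by have := hq n; omega) hle
        (hcop hmn.symm) _ _
  refine measure_limsup_ne_zero_of_quasiIndependent (fun n => isOpen_thickening.measurableSet)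
    (fun hE => hsum ?_) (C := 5 / (2 * c ^ 2)) (by positivity) fun m n hmn => ?_
  · exact (summable_mul_left_iff (by positivity)).1
      (hE.of_nonneg_of_le (fun n => by positivity) hlower)
  · calc volume.real (E m ∩ E n) ≤ 10 / (q m * q n) := hoverlap hmn
      _ = 5 / (2 * c ^ 2) * (2 * c * (1 / q m) * (2 * c * (1 / q n))) := by
          field_simp
          norm_num
      _ ≤ _ := by
          gcongr
          exacts [hlower m, hlower n]

theorem ae_frequently_mem_thickening_residueFractions (hd : d ≠ 0) {q : ℕ → ℕ}
    (hq : ∀ n, 2 ≤ q n) (hcop : Pairwise (Nat.Coprime on q))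
    (hsum : ¬ Summable fun n => 1 / (q n : ℝ)) {R : ∀ n, Set (ZMod (q n))} {c : ℝ} (hc : 0 < c)
    (hR : ∀ n, c * q n ≤ (R n).ncard) {k : ℕ} (hk : 1 < k)
    (hkR : ∀ n, ∀ x ∈ R n, (k : ZMod (q n)) * x ∈ R n) :
    ∀ᵐ x : UnitAddCircle, ∃ᶠ n in atTop,
      x ∈ thickening (1 / (q n : ℝ) ^ (d + 1)) (residueFractions d (R n)) :=
  ae_frequently_mem_thickening_of_measure_limsup_ne_zero
    (tendsto_one_div_pow_succ_of_pairwise_coprime hq hcop d) hk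
    (fun n _ => nsmul_mem_residueFractions (hkR n))
    (measure_limsup_thickening_residueFractions_ne_zero hd hq hcop hsum hc hR)

end ResidueFractions

section PrimeDenominators

theorem residueDilate_primitivePowerResidues_eq_image {p : ℕ} [Fact p.Prime] (a : ℤ) (d : ℕ) :
    residueDilate a (primitivePowerResidues d p) = (fun y : ZMod p => a * y ^ d) '' {0}ᶜ := by
  ext x
  constructor
  · rintro ⟨_, ⟨y, hy, rfl⟩, rfl⟩
    exact ⟨y, hy.ne_zero, rfl⟩
  · rintro ⟨y, hy, rfl⟩
    exact ⟨y ^ d, ⟨y, isUnit_iff_ne_zero.2 hy, rfl⟩, rfl⟩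

theorem card_sub_one_le_mul_ncard_image_mul_pow {F : Type*} [Field F] [Finite F] {d : ℕ}
    (hd : d ≠ 0) {a : F} (ha : a ≠ 0) :
    Nat.card F - 1 ≤ d * ((fun y : F => a * y ^ d) '' {0}ᶜ).ncard := by
  classical
  have := Fintype.ofFinite F
  have hfiber (b : F) : (({0}ᶜ : Finset F).filter fun y => a * y ^ d = b).card ≤ d := by
    refine (Finset.card_le_card (t := (nthRoots d (b / a)).toFinset) fun y hy => ?_).trans
      ((Multiset.toFinset_card_le _).trans (card_nthRoots d _))
    rw [Multiset.mem_toFinset, mem_nthRoots hd.pos, ← (Finset.mem_filter.1 hy).2,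
      mul_div_cancel_left₀ _ ha]
  have hcard := Finset.card_le_mul_card_image ({0}ᶜ : Finset F) d fun b _ => hfiber b
  rwa [Finset.card_compl, Finset.card_singleton, ← Nat.card_eq_fintype_card,
    ← Set.ncard_coe_finset, Finset.coe_image, Finset.coe_compl, Finset.coe_singleton] at hcard

theorem le_two_mul_mul_ncard_residueDilate {d p : ℕ} (hd : d ≠ 0) (hp : p.Prime) {a : ℤ}
    (ha : ¬ (p : ℤ) ∣ a) :
    p ≤ 2 * d * (residueDilate a (primitivePowerResidues d p)).ncard := by
  have : Fact p.Prime := ⟨hp⟩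
  have hcard := card_sub_one_le_mul_ncard_image_mul_pow hd
    (mt (ZMod.intCast_zmod_eq_zero_iff_dvd a p).1 ha)
  rw [Nat.card_zmod] at hcard
  rw [residueDilate_primitivePowerResidues_eq_image, mul_assoc]
  have := hp.two_le
  omega

theorem pow_mul_mem_residueDilate {a : ℤ} {d q : ℕ} {k x : ZMod q} (hk : IsUnit k)
    (hx : x ∈ residueDilate a (primitivePowerResidues d q)) :
    k ^ d * x ∈ residueDilate a (primitivePowerResidues d q) := by
  obtain ⟨_, ⟨y, hy, rfl⟩, rfl⟩ := hx
  exact ⟨(k * y) ^ d, ⟨k * y, hk.mul hy, rfl⟩, by ring⟩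

theorem not_summable_one_div_on_primes_not_dvd {K : ℕ} (hK : K ≠ 0) :
    ¬ Summable ({p : ℕ | p.Prime ∧ ¬ p ∣ K}.indicator fun n : ℕ => (1 : ℝ) / n) := by
  refine fun h => not_summable_one_div_on_primes (h.congr_cofinite ?_)
  have hfin : {p : ℕ | p ∣ K}.Finite :=
    K.divisors.finite_toSet.subset fun p hp => by simpa [hK] using hp
  filter_upwards [hfin.compl_mem_cofinite] with p hp
  have hpK : ¬ p ∣ K := hp
  simp only [Set.indicator, Set.mem_ofPred_eq, hpK, not_false_eq_true, and_true]

theorem exists_strictMono_not_summable_of_not_summable_indicator {s : Set ℕ} {f : ℕ → ℝ}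
    (hf : ¬ Summable (s.indicator f)) :
    ∃ u : ℕ → ℕ, StrictMono u ∧ (∀ n, u n ∈ s) ∧ ¬ Summable fun n => f (u n) := by
  have hs : s.Infinite := fun hfin => hf (summable_of_hasFiniteSupport
    (hfin.subset Set.support_indicator_subset))
  refine ⟨Nat.nth (· ∈ s), Nat.nth_strictMono hs, Nat.nth_mem_of_infinite hs, ?_⟩
  refine mt (fun h => ?_) hf
  refine ((Nat.nth_injective hs).summable_iff fun n hn => Set.indicator_of_notMem ?_ f).1
    (h.congr fun n => (Set.indicator_of_mem (Nat.nth_mem_of_infinite hs n) f).symm)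
  rwa [Nat.range_nth_of_infinite hs] at hn

theorem exists_prime_seq_not_dvd_not_summable {K : ℕ} (hK : K ≠ 0) :
    ∃ p : ℕ → ℕ, StrictMono p ∧ (∀ n, (p n).Prime ∧ ¬ p n ∣ K) ∧
      ¬ Summable fun n => 1 / (p n : ℝ) :=
  exists_strictMono_not_summable_of_not_summable_indicator
    (not_summable_one_div_on_primes_not_dvd hK)

theorem ae_frequently_mem_thickening_prime_residueFractions {d : ℕ} (hd : d ≠ 0) {a : ℤ}
    {p : ℕ → ℕ} (hinj : Injective p) (hp : ∀ n, (p n).Prime) (hpa : ∀ n, ¬ (p n : ℤ) ∣ 2 * a)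
    (hsum : ¬ Summable fun n => 1 / (p n : ℝ)) :
    ∀ᵐ x : UnitAddCircle, ∃ᶠ n in atTop, x ∈ thickening (1 / (p n : ℝ) ^ (d + 1))
      (residueFractions d (residueDilate a (primitivePowerResidues d (p n)))) := by
  have hcop : Pairwise (Nat.Coprime on p) := fun m n hmn =>
    (Nat.coprime_primes (hp m) (hp n)).2 (hinj.ne hmn)
  have hcard (n : ℕ) : 1 / (2 * d : ℝ) * p n ≤
      (residueDilate a (primitivePowerResidues d (p n))).ncard := by
    rw [one_div_mul_eq_div, div_le_iff₀' (by positivity)]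
    exact_mod_cast le_two_mul_mul_ncard_residueDilate hd (hp n) fun h => hpa n (h.mul_left 2)
  have hunit (n : ℕ) : IsUnit (2 : ZMod (p n)) := by
    rw [← Nat.cast_two, ZMod.isUnit_iff_coprime, Nat.coprime_comm, (hp n).coprime_iff_not_dvd]
    exact fun h => hpa n ((Int.natCast_dvd_natCast.2 h).mul_right a)
  refine ae_frequently_mem_thickening_residueFractions hd (fun n => (hp n).two_le) hcop hsum
    (by positivity) hcard (Nat.one_lt_two_pow hd) fun n x hx => ?_
  simpa only [Nat.cast_pow, Nat.cast_two] using pow_mul_mem_residueDilate (hunit n) hx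

theorem ae_infinite_prime_approximations {d : ℕ} (hd : d ≠ 0) {a : ℤ} (ha : a ≠ 0) {τ : ℝ}
    (hτ : τ ≤ d + 1) :
    ∀ᵐ α : ℝ, {p : ℕ × ℤ | p.1.Prime ∧ |α - (p.2 : ℝ) / (p.1 : ℝ) ^ d| < 1 / (p.1 : ℝ) ^ τ ∧
      (p.2 : ZMod p.1) ∈ residueDilate a (primitivePowerResidues d p.1) ∧
      Int.gcd (p.1 : ℤ) (d * a) = 1}.Infinite := by
  obtain ⟨p, hmono, hp, hsum⟩ :=
    exists_prime_seq_not_dvd_not_summable (K := (2 * (d * a)).natAbs) (by simp [hd, ha])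
  have hprime (n : ℕ) : (p n).Prime := (hp n).1
  have hpda (n : ℕ) : ¬ (p n : ℤ) ∣ 2 * (d * a) := fun h => (hp n).2 (Int.natCast_dvd.1 h)
  have hfrequently := ae_coe_addCircle_of_ae
    (ae_frequently_mem_thickening_prime_residueFractions hd hmono.injective hprime
      (fun n h => hpda n (mul_left_comm (2 : ℤ) d a ▸ h.mul_left d)) hsum)
  filter_upwards [hfrequently] with α hα
  refine Set.Infinite.of_image Prod.fst ?_
  refine ((Nat.frequently_atTop_iff_infinite.1 hα).image hmono.injective.injOn).mono ?_
  rintro _ ⟨n, hn, rfl⟩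
  obtain ⟨b, hb, hαb⟩ :=
    (coe_mem_thickening_residueFractions_iff hd (hprime n).ne_zero).1 hn
  refine ⟨(p n, b), ⟨hprime n, hαb.trans_le ?_, hb, ?_⟩, rfl⟩
  · have hone : (1 : ℝ) ≤ p n := by exact_mod_cast (hprime n).one_le
    gcongr
    rw [← Real.rpow_natCast]
    exact Real.rpow_le_rpow_of_exponent_le hone (by exact_mod_cast hτ)
  · have hp_int : Prime (p n : ℤ) := Nat.prime_iff_prime_int.1 (hprime n)
    exact Int.isCoprime_iff_gcd_eq_one.1
      (hp_int.coprime_iff_not_dvd.2 fun h => hpda n (h.mul_left 2))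

end PrimeDenominators

theorem negLeadingCoeff_ne_zero {P : ℤ[X]} (hP : P.natDegree ≠ 0) : negLeadingCoeff P ≠ 0 :=
  neg_ne_zero.2 (leadingCoeff_ne_zero.2 (ne_zero_of_natDegree_gt hP.pos))

theorem ITilde_subset_IStar (P : ℤ[X]) (τ : ℝ) : ITilde P τ ⊆ IStar P τ := by
  rintro α ⟨hα, hinf⟩
  refine ⟨hα, hinf.mono ?_⟩
  rintro p ⟨hone, hdist, ⟨x, ⟨y, -, hxy⟩, hpx⟩, -⟩
  exact ⟨hone, hdist, x, ⟨y, hxy⟩, hpx⟩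

theorem volume_eq_one_of_ae_mem_of_subset_Ioo {S : Set ℝ} (hS : S ⊆ Set.Ioo 0 1)
    (hae : ∀ᵐ α, α ∈ Set.Ioo (0 : ℝ) 1 → α ∈ S) : volume S = 1 := by
  rw [measure_congr (hS.eventuallyLE.antisymm hae), Real.volume_Ioo, sub_zero, ENNReal.ofReal_one]

theorem mainTheorem4_general (P : ℤ[X]) (hP : P.natDegree ≠ 0) :
    (∀ (s : ℝ) (m : ℕ), s ≤ 1 → 1 ≤ m →
      ∀ᵐ α : ℝ ∂volume,
        {p : ℕ × ℤ | 1 ≤ p.1 ∧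
          |α - (p.2 : ℝ) / (p.1 : ℝ) ^ P.natDegree| <
            1 / (p.1 : ℝ) ^ ((P.natDegree : ℝ) + s) ∧
          (p.2 : ZMod p.1) ∈
            residueDilate (negLeadingCoeff P) (primitivePowerResidues P.natDegree p.1) ∧
          Int.gcd (p.1 : ℤ) ((P.natDegree : ℤ) * negLeadingCoeff P) = 1 ∧
          ArithmeticFunction.cardDistinctFactors p.1 ≤ m}.Infinite) ∧
    (∀ τ : ℝ, τ ≤ (P.natDegree : ℝ) + 1 →
      volume (ITilde P τ) = 1 ∧ volume (IStar P τ) = 1) := by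
  have hprime {τ : ℝ} (hτ : τ ≤ P.natDegree + 1) :=
    ae_infinite_prime_approximations hP (negLeadingCoeff_ne_zero hP) hτ
  refine ⟨fun s m hs hm => ?_, fun τ hτ => ?_⟩
  · filter_upwards [hprime (add_le_add_right hs _)] with α hα
    refine hα.mono ?_
    rintro p ⟨hp, hdist, hmem, hgcd⟩
    refine ⟨hp.one_le, hdist, hmem, hgcd, ?_⟩
    rwa [ArithmeticFunction.cardDistinctFactors_apply_prime hp]
  · have hae : ∀ᵐ α, α ∈ Set.Ioo (0 : ℝ) 1 → α ∈ ITilde P τ := by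
      filter_upwards [hprime hτ] with α hα hα01
      exact ⟨hα01, hα.mono fun _ hp => ⟨hp.1.one_le, hp.2⟩⟩
    exact ⟨volume_eq_one_of_ae_mem_of_subset_Ioo (fun α hα => hα.1) hae,
      volume_eq_one_of_ae_mem_of_subset_Ioo (fun α hα => hα.1)
        (hae.mono fun α hα hα01 => ITilde_subset_IStar P τ (hα hα01))⟩

theorem mainTheorem4 (P : ℤ[X]) (hP : 2 ≤ P.natDegree) :
    (∀ (s : ℝ) (m : ℕ), 0 < s → s ≤ 1 → 1 ≤ m →
      ∀ᵐ α : ℝ ∂volume,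
        {p : ℕ × ℤ | 1 ≤ p.1 ∧
          |α - (p.2 : ℝ) / (p.1 : ℝ) ^ P.natDegree| <
            1 / (p.1 : ℝ) ^ ((P.natDegree : ℝ) + s) ∧
          (p.2 : ZMod p.1) ∈
            residueDilate (negLeadingCoeff P) (primitivePowerResidues P.natDegree p.1) ∧
          Int.gcd (p.1 : ℤ) ((P.natDegree : ℤ) * negLeadingCoeff P) = 1 ∧
          ArithmeticFunction.cardDistinctFactors p.1 ≤ m}.Infinite) ∧
    (∀ τ : ℝ, τ ≤ (P.natDegree : ℝ) + 1 →
      volume (ITilde P τ) = 1 ∧ volume (IStar P τ) = 1) :=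
  have hgeneral := mainTheorem4_general P (by omega)
  ⟨fun s m _ => hgeneral.1 s m, hgeneral.2⟩
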